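/- **Notation.** For a set $C$ of ordinals let $\mathrm{acc}(C)=\{\alpha\in C:\sup(C\cap\alpha)=\alpha>0\}$ and $\mathrm{nacc}(C)=C\setminus\mathrm{acc}(C)$; for $j<\mathrm{otp}(C)$ let $C(j)$ be the unique $\delta\in C$ with $\mathrm{otp}(C\cap\delta)=j$; for an ordinal $\sigma$ let $\mathrm{succ}_\sigma(C)=\{C(j+1): j<\sigma,\ j+1<\mathrm{otp}(C)\}$. Write $D\sqsubseteq C$ if $D=C\cap\beta$ for some ordinal $\beta$; $D\sqsubseteq_\chi C$ if $D\sqsubseteq C$, or $\mathrm{otp}(C)<\chi$ and $\mathrm{nacc}(C)$ consists only of successor ordinals; $D\sqsubseteq^*_\chi C$ if $D\sqsubseteq C$ or $\mathrm{cf}(\sup D)<\chi$. Let $E^\kappa_{\ge\chi}=\{\alpha<\kappa:\mathrm{cf}(\alpha)\ge\chi\}$. For a regular uncountable cardinal $\kappa$, a binary relation $\mathcal R$ between sets of ordinals, a cardinal $\theta\le\kappa$, a nonempty family $\mathcal S$ of stationary subsets of $\kappa$ and an ordinal $\sigma\le\kappa$, the principle $\mathrm P^-(\kappa,2,\mathcal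 R,\theta,\mathcal S,2,\sigma)$ asserts that there is a sequence $\langle C_\alpha:\alpha<\kappa\rangle$ such that (i) $C_\alpha$ is a club in $\alpha$ for every limit $\alpha<\kappa$; (ii) $C_{\bar\alpha}\mathrel{\mathcal R}C_\alpha$ for every limit $\alpha<\kappa$ and every $\bar\alpha\in\mathrm{acc}(C_\alpha)$; (iii) for every sequence $\langle A_i:i<\theta\rangle$ of cofinal subsets of $\kappa$ and every $S\in\mathcal S$ there are stationarily many $\alpha\in S$ such that $\sup\{\beta\in C_\alpha:\mathrm{succ}_\sigma(C_\alpha\setminus\beta)\subseteq A_i\}=\alpha$ for all $i<\min\{\alpha,\theta\}$. The principle $\mathrm P(\kappa,2,\mathcal R,\theta,\mathcal S,2,\sigma)$ is the conjunction of $\mathrm P^-(\kappa,2,\mathcal R,\theta,\mathcal S,2,\sigma)$ and Jensen's $\diamondsuit(\kappa)$. For cardinals $\mu\le\nu$, a graph $\mathcal G$ is $(\mu,\nu)$-chromatic if its chromatic number is $\nu$ and every subgraph $\mathcal G'$ with $|V(\mathcal G')|<|V(\mathcal G)|$ has chromatic number at most $\mu$. It is $(\mu,>\theta)$-chromatic if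 it is $(\mu,\nu)$-chromatic for some cardinal $\nu>\theta$. The size of $\mathcal G$ is $|V(\mathcal G)|$. **Statement.** Let $\chi<\kappa$ be infinite regular cardinals and let $\theta<\kappa$ be a cardinal. Then: 1. $\mathrm P(\kappa,2,\sqsubseteq_\chi,\theta,\{\kappa\},2,1)$ entails the existence of a $(\chi,>\theta)$-chromatic graph of size $\kappa$; 2. $\mathrm P^-(\kappa,2,\sqsubseteq_\chi,\kappa,\{\kappa\},2,2)$ entails the existence of a $(\chi,\kappa)$-chromatic graph of size $\kappa$; 3. $\mathrm P^-(\kappa,2,\sqsubseteq^*_\chi,\kappa,\{E^\kappa_{\ge\chi}\},2,2)$ entails the existence of a $(\chi,\kappa)$-chromatic graph of size $\kappa$; 4. $\mathrm P(\kappa,2,\sqsubseteq^*_\chi,\theta,\{E^\kappa_{\ge\chi}\},2,1)$ entails the existence of a $(\chi,>\theta)$-chromatic graph of size $\kappa$. -/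

import Mathlib

open Set Cardinal

universe u

namespace CSeq

/-! Sets of ordinals below a cardinal `κ` are modelled as `Set Ordinal.{u}`; the cardinal `κ` itself,
viewed as a set of ordinals, is `Set.Iio κ.ord`. All suprema below are of bounded sets, and
`sSup ∅ = 0`. -/

/-- `acc C = {α ∈ C ∣ sup (C ∩ α) = α > 0}`. -/
def acc (C : Set Ordinal.{u}) : Set Ordinal.{u} :=
  {α | α ∈ C ∧ sSup (C ∩ Iio α) = α ∧ 0 < α}

/-- `nacc C = C \ acc C`. -/
def nacc (C : Set Ordinal.{u}) : Set Ordinal.{u} :=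
  C \ acc C

/-- The order type of a set of ordinals. -/
noncomputable def otp (C : Set Ordinal.{u}) : Ordinal.{u + 1} :=
  Ordinal.type (fun x y : C => x < y)

/-- `IsNth C j δ` says that `δ = C(j)`, the unique `δ ∈ C` with `otp (C ∩ δ) = j`. -/
def IsNth (C : Set Ordinal.{u}) (j δ : Ordinal.{u}) : Prop :=
  δ ∈ C ∧ otp (C ∩ Iio δ) = Ordinal.lift.{u + 1} j

/-- `suc σ C = {C(j+1) ∣ j < σ, j + 1 < otp C}`. -/
def suc (σ : Ordinal.{u}) (C : Set Ordinal.{u}) : Set Ordinal.{u} :=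
  {δ | ∃ j < σ, Ordinal.lift.{u + 1} (j + 1) < otp C ∧ IsNth C (j + 1) δ}

/-- `C` is a closed and unbounded subset of the ordinal `α`. -/
def IsClubIn (C : Set Ordinal.{u}) (α : Ordinal.{u}) : Prop :=
  C ⊆ Iio α ∧ IsClub {x : Iio α | (x : Ordinal.{u}) ∈ C}

/-- The set of all ordinals `α < κ` with `α ∈ S` is stationary in `κ`. -/
def StationaryIn (S : Set Ordinal.{u}) (κ : Cardinal.{u}) : Prop :=
  IsStationary {x : Iio κ.ord | (x : Ordinal.{u}) ∈ S}

/-- `A` is a cofinal subset of `κ`. -/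
def CofinalIn (A : Set Ordinal.{u}) (κ : Cardinal.{u}) : Prop :=
  A ⊆ Iio κ.ord ∧ ∀ β < κ.ord, ∃ α ∈ A, β ≤ α

/-- `D ⊑ C`: `D` is an initial segment of `C`. -/
def InitSeg (D C : Set Ordinal.{u}) : Prop :=
  ∃ β : Ordinal.{u}, D = C ∩ Iio β

/-- `D ⊑_χ C`: either `D ⊑ C`, or `otp C < χ` and `nacc C` consists only of successor ordinals. -/
def InitSegSub (χ : Cardinal.{u}) (D C : Set Ordinal.{u}) : Prop :=
  InitSeg D C ∨
    (otp C < Ordinal.lift.{u + 1} χ.ord ∧ ∀ γ ∈ nacc C, ∃ β : Ordinal.{u}, γ = β + 1)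

/-- `D ⊑*_χ C`: either `D ⊑ C`, or `cf (sup D) < χ`. -/
def InitSegStar (χ : Cardinal.{u}) (D C : Set Ordinal.{u}) : Prop :=
  InitSeg D C ∨ (sSup D).cof < χ

/-- `E^κ_{≥χ} = {α < κ ∣ cf α ≥ χ}`. -/
def cofGE (κ χ : Cardinal.{u}) : Set Ordinal.{u} :=
  {α | α < κ.ord ∧ χ ≤ α.cof}

/-- The principle `P⁻(κ, 2, R, θ, 𝒮, 2, σ)`. -/
def ProxyMinus (κ : Cardinal.{u}) (R : Set Ordinal.{u} → Set Ordinal.{u} → Prop)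
    (θ : Cardinal.{u}) (𝒮 : Set (Set Ordinal.{u})) (σ : Ordinal.{u}) : Prop :=
  ∃ C : Ordinal.{u} → Set Ordinal.{u},
    (∀ α < κ.ord, Order.IsSuccLimit α → IsClubIn (C α) α) ∧
    (∀ α < κ.ord, Order.IsSuccLimit α → ∀ β ∈ acc (C α), R (C β) (C α)) ∧
    ∀ A : Ordinal.{u} → Set Ordinal.{u}, (∀ i < θ.ord, CofinalIn (A i) κ) →
      ∀ S ∈ 𝒮, StationaryIn
        {α | α ∈ S ∧ ∀ i < min α θ.ord,
          sSup {β | β ∈ C α ∧ suc σ (C α \ Iio β) ⊆ A i} = α} κ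

/-- Jensen's diamond principle `◇(κ)`. -/
def Diamond (κ : Cardinal.{u}) : Prop :=
  ∃ S : Ordinal.{u} → Set Ordinal.{u}, (∀ α < κ.ord, S α ⊆ Iio α) ∧
    ∀ A ⊆ Iio κ.ord, StationaryIn {α | A ∩ Iio α = S α} κ

/-- The principle `P(κ, 2, R, θ, 𝒮, 2, σ)`. -/
def Proxy (κ : Cardinal.{u}) (R : Set Ordinal.{u} → Set Ordinal.{u} → Prop)
    (θ : Cardinal.{u}) (𝒮 : Set (Set Ordinal.{u})) (σ : Ordinal.{u}) : Prop :=
  ProxyMinus κ R θ 𝒮 σ ∧ Diamond κ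

/-- The chromatic number as a cardinal: the least `μ` such that the graph has a proper vertex
coloring with a set of `μ` colors. (The set of such `μ` contains `#V`, so it is nonempty.) -/
noncomputable def chr {V : Type u} (G : SimpleGraph V) : Cardinal.{u} :=
  sInf {μ | ∃ K : Type u, #K = μ ∧ Nonempty (G.Coloring K)}

/-- `G` is `(μ, ν)`-chromatic. -/
def IsChromatic {V : Type u} (G : SimpleGraph V) (μ ν : Cardinal.{u}) : Prop :=
  μ ≤ ν ∧ chr G = ν ∧ ∀ H : G.Subgraph, #H.verts < #V → chr H.coe ≤ μ

/-- `G` is `(μ, >θ)`-chromatic: it is `(μ, ν)`-chromatic for some cardinal `ν > θ`. -/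
def IsChromaticGT {V : Type u} (G : SimpleGraph V) (μ θ : Cardinal.{u}) : Prop :=
  ∃ ν, θ < ν ∧ IsChromatic G μ ν

end CSeq

namespace CSeq

/-! All four parts reduce to `⊑*_χ`-coherence and stationary subsets of `κ`: an accumulation point
of a set of order type below `χ` has cofinality below `χ`, and a stationary set of guesses inside
`E^κ_{≥χ}` is stationary in `κ`.

The graph lives on `κ × κ`. For `δ` limit, each interval `(pre α, α]` given by a point `α` of `C δ`
contributes at most one level `e`, chosen by `f`; then `(δ, η)` is joined to all `(e, ξ)` with `η ≤
pre α < ξ`.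

Large chromatic number (`Guesses.not_proper`): given a coloring by `θ < κ` colors, each color `i`
that occurs unboundedly in both coordinates yields a cofinal set `A i` such that for `γ < e` in `A
i` some `(e, ξ)` with `ξ > γ` has color `i`. Guess all `A i` at one `δ` above the bounds of the
remaining colors. The color of `(δ, η)`, for `η < δ` above these bounds, is then an unbounded color,
and two points `γ < e` of `A i` in one interval of `C δ` give a monochromatic edge. With `σ = 2` the
two points are consecutive in `C δ`; with `σ = 1` they are read off the diamond set at `α`.

Small subgraphs (`extendible`): a subgraph of size less than `κ` lies below some level `δ < κ`.
Colorings by `χ` colors are extended level by level, keeping fewer than `χ` colors on each level and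
on its potential neighbors, and leaving the color of the upper part of the last level free.
Coherence is needed only at points of cofinality at least `χ`; elsewhere regularity of `χ` bounds
the unions. -/

/-! ### Unboundedness and coherence. -/

/-- The supremum of the elements of `D` below `α`. -/
noncomputable def pre (D : Set Ordinal.{u}) (α : Ordinal.{u}) : Ordinal.{u} :=
  sSup (D ∩ Iio α)

theorem pre_le (D : Set Ordinal.{u}) (α : Ordinal.{u}) : pre D α ≤ α :=
  csSup_le' fun _ h => h.2.le

theorem le_pre {D : Set Ordinal.{u}} {α β : Ordinal.{u}} (hβ : β ∈ D) (h : β < α) :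
    β ≤ pre D α :=
  le_csSup ⟨α, fun _ h => h.2.le⟩ ⟨hβ, h⟩

theorem pre_inter_Iio {D : Set Ordinal.{u}} {α x : Ordinal.{u}} (h : α ≤ x) :
    pre (D ∩ Iio x) α = pre D α := by
  unfold pre
  congr 1
  ext y
  simp only [mem_inter_iff, mem_Iio]
  exact ⟨fun h => ⟨h.1.1, h.2⟩, fun h' => ⟨⟨h'.1, h'.2.trans_le h⟩, h'.2⟩⟩

/-- If nothing in `D` lies in `[y, β)`, then `D` has the same elements below `y` and `β`. -/
theorem inter_Iio_eq_of_pre_lt {D : Set Ordinal.{u}} {y β : Ordinal.{u}} (h : pre D β < y)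
    (hy : y ≤ β) : D ∩ Iio y = D ∩ Iio β := by
  ext z
  simp only [mem_inter_iff, mem_Iio]
  exact ⟨fun h => ⟨h.1, h.2.trans_le hy⟩, fun h' => ⟨h'.1, (le_pre h'.1 h'.2).trans_lt h⟩⟩

/-- A set of ordinals is unbounded below `x`. -/
def UnbddBelow (D : Set Ordinal.{u}) (x : Ordinal.{u}) : Prop :=
  ∀ b < x, ∃ α ∈ D, b ≤ α ∧ α < x

theorem UnbddBelow.pre_eq {D : Set Ordinal.{u}} {x : Ordinal.{u}} (h : UnbddBelow D x)
    (hx : Order.IsSuccLimit x) : pre D x = x := by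
  refine (pre_le D x).antisymm (le_of_not_gt fun hlt => ?_)
  obtain ⟨α, hα, h1, h2⟩ := h _ (hx.succ_lt hlt)
  exact (Order.lt_succ _).not_ge (h1.trans (le_pre hα h2))

theorem UnbddBelow.of_pre_eq {D : Set Ordinal.{u}} {x : Ordinal.{u}} (h : pre D x = x) :
    UnbddBelow D x := by
  intro b hb
  by_contra! hcon
  refine hb.not_ge (h ▸ csSup_le' fun y hy => le_of_not_ge fun hby => ?_)
  exact (hcon y hy.1 hby).not_gt hy.2

theorem UnbddBelow.isSuccLimit {D : Set Ordinal.{u}} {x : Ordinal.{u}} (h : UnbddBelow D x)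
    (h' : pre D x = x) (h0 : 0 < x) : Order.IsSuccLimit x := by
  rcases Ordinal.zero_or_succ_or_isSuccLimit x with rfl | ⟨y, rfl⟩ | hx
  · exact absurd h0 (lt_irrefl _)
  · have : pre D (Order.succ y) ≤ y := csSup_le' fun z hz => Order.lt_succ_iff.1 hz.2
    exact absurd (h' ▸ this) (Order.lt_succ y).not_ge
  · exact hx

/-- The facts on a `⊑*_χ`-coherent `C`-sequence of length `o` used below. -/
structure StarSeq (χ : Cardinal.{u}) (o : Ordinal.{u}) (C : Ordinal.{u} → Set Ordinal.{u}) :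
    Prop where
  sub : ∀ δ < o, Order.IsSuccLimit δ → C δ ⊆ Iio δ
  unbdd : ∀ δ < o, Order.IsSuccLimit δ → UnbddBelow (C δ) δ
  closed : ∀ δ < o, Order.IsSuccLimit δ → ∀ x < δ, Order.IsSuccLimit x → UnbddBelow (C δ) x →
    x ∈ C δ
  coh : ∀ δ < o, Order.IsSuccLimit δ → ∀ x < δ, Order.IsSuccLimit x → UnbddBelow (C δ) x →
    x.cof < χ ∨ C x = C δ ∩ Iio x

/-! ### Counting the colors of potential neighbors. -/

section Graph

variable (f : Ordinal.{u} → Ordinal.{u} → Ordinal.{u})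

/-- `e` is the point that `f` picks in the interval of `D` ending at `α`. -/
def Nbr (D : Set Ordinal.{u}) (α e : Ordinal.{u}) : Prop :=
  α ∈ D ∧ e = f (pre D α) α ∧ pre D α < e ∧ e ≤ α

variable {K : Type u}

/-- The colors of the potential neighbors below `x`. -/
def nbrColors (c : Ordinal.{u} → Ordinal.{u} → K) (D : Set Ordinal.{u}) (x : Ordinal.{u}) :
    Set K :=
  {k | ∃ α e ξ, Nbr f D α e ∧ α < x ∧ pre D α < ξ ∧ c e ξ = k}

theorem nbrColors_inter_Iio (c : Ordinal.{u} → Ordinal.{u} → K) (D : Set Ordinal.{u})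
    (x : Ordinal.{u}) : nbrColors f c (D ∩ Iio x) x = nbrColors f c D x := by
  ext k
  constructor
  · rintro ⟨α, e, ξ, ⟨h1, h2, h3, h4⟩, h5, h6, h7⟩
    rw [pre_inter_Iio h5.le] at *
    exact ⟨α, e, ξ, ⟨h1.1, h2, h3, h4⟩, h5, h6, h7⟩
  · rintro ⟨α, e, ξ, ⟨h1, h2, h3, h4⟩, h5, h6, h7⟩
    refine ⟨α, e, ξ, ?_, h5, ?_, h7⟩
    · unfold Nbr
      rw [pre_inter_Iio h5.le]
      exact ⟨⟨h1, h5⟩, h2, h3, h4⟩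
    · rwa [pre_inter_Iio h5.le]

theorem nbrColors_congr {c c' : Ordinal.{u} → Ordinal.{u} → K} (D : Set Ordinal.{u})
    {x : Ordinal.{u}} (h : ∀ y < x, c y = c' y) : nbrColors f c D x = nbrColors f c' D x := by
  ext k
  constructor
  · rintro ⟨α, e, ξ, h1, h2, h3, h4⟩
    exact ⟨α, e, ξ, h1, h2, h3, by rw [← h e (h1.2.2.2.trans_lt h2)]; exact h4⟩
  · rintro ⟨α, e, ξ, h1, h2, h3, h4⟩
    exact ⟨α, e, ξ, h1, h2, h3, by rw [h e (h1.2.2.2.trans_lt h2)]; exact h4⟩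

variable (χ : Cardinal.{u}) (C : Ordinal.{u} → Set Ordinal.{u})

/-- The coloring `c` is proper at level `δ` and uses few colors on level `δ` and on the potential
neighbors of level `δ`. -/
def Good (c : Ordinal.{u} → Ordinal.{u} → K) (δ : Ordinal.{u}) : Prop :=
  #(range (c δ)) < χ ∧ (Order.IsSuccLimit δ → #(nbrColors f c (C δ) δ) < χ ∧
    ∀ α e ξ η, Nbr f (C δ) α e → α < δ → pre (C δ) α < ξ → η ≤ pre (C δ) α → c e ξ ≠ c δ η)

variable {χ C}

theorem Good.congr {c c' : Ordinal.{u} → Ordinal.{u} → K} {δ : Ordinal.{u}}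
    (hc : Good f χ C c δ) (h : ∀ y ≤ δ, c y = c' y) : Good f χ C c' δ := by
  refine ⟨h δ le_rfl ▸ hc.1, fun hδ => ⟨?_, ?_⟩⟩
  · rw [← nbrColors_congr f (C δ) fun y hy => h y hy.le]
    exact (hc.2 hδ).1
  · intro α e ξ η h1 h2 h3 h4
    rw [← h δ le_rfl, ← h e (h1.2.2.2.trans h2.le)]
    exact (hc.2 hδ).2 α e ξ η h1 h2 h3 h4

theorem mk_union_lt (hχ : ℵ₀ ≤ χ) {A B : Set K} (hA : #A < χ) (hB : #B < χ) :
    #(A ∪ B : Set K) < χ :=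
  (mk_union_le A B).trans_lt (add_lt_of_lt hχ hA hB)

/-- Induction on `x`: a successor step adds the colors of at most one level, and a limit of
cofinality below `χ` is a union of fewer than `χ` small sets. At a limit `x < δ` of cofinality at
least `χ`, either `C δ` is bounded below `x`, or coherence gives `C x = C δ ∩ x` and goodness at `x`
already contains the bound. The case `x = δ` of large cofinality has no such source, hence the extra
hypothesis. -/
theorem mk_nbrColors_lt {o : Ordinal.{u}} (hχ : χ.IsRegular) (S : StarSeq χ o C)
    {c : Ordinal.{u} → Ordinal.{u} → K} {δ : Ordinal.{u}} (hδo : δ < o)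
    (hδ : Order.IsSuccLimit δ) (x : Ordinal.{u}) (hxδ : x ≤ δ) (hx : x = δ → δ.cof < χ)
    (hc : ∀ β < δ, β ≤ x → Good f χ C c β) : #(nbrColors f c (C δ) x) < χ := by
  induction x using WellFoundedLT.induction with
  | ind x ih =>
  have ih' : ∀ y < x, #(nbrColors f c (C δ) y) < χ := fun y hy =>
    ih y hy (hy.le.trans hxδ) (fun h => absurd (h ▸ hy) hxδ.not_gt)
      fun β hβ hβy => hc β hβ (hβy.trans hy.le)
  rcases Ordinal.zero_or_succ_or_isSuccLimit x with rfl | ⟨y, rfl⟩ | hlim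
  · have : nbrColors f c (C δ) 0 = ∅ := by
      ext k
      simp [nbrColors]
    rw [this, mk_eq_zero]
    exact hχ.pos
  · have hy := ih' y (Order.lt_succ y)
    have hyδ : y < δ := (Order.lt_succ y).trans_le hxδ
    by_cases h : ∃ e, Nbr f (C δ) y e
    · obtain ⟨e, he⟩ := h
      have hg := (hc e (he.2.2.2.trans_lt hyδ) (he.2.2.2.trans (Order.le_succ y))).1
      refine (mk_le_mk_of_subset ?_).trans_lt (mk_union_lt hχ.aleph0_le hy hg)
      rintro k ⟨α, e', ξ, h1, h2, h3, h4⟩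
      rcases (Order.lt_succ_iff.1 h2).lt_or_eq with h5 | rfl
      · exact Or.inl ⟨α, e', ξ, h1, h5, h3, h4⟩
      · right
        rw [he.2.1, ← h1.2.1]
        exact ⟨ξ, h4⟩
    · refine (mk_le_mk_of_subset ?_).trans_lt hy
      rintro k ⟨α, e', ξ, h1, h2, h3, h4⟩
      refine ⟨α, e', ξ, h1, (Order.lt_succ_iff.1 h2).lt_of_ne ?_, h3, h4⟩
      rintro rfl
      exact h ⟨e', h1⟩
  · by_cases hcof : x.cof < χ
    · obtain ⟨s, hs, hs'⟩ := Order.exists_cof_eq x.ToType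
      rw [Ordinal.cof_toType] at hs'
      have : nbrColors f c (C δ) x ⊆
          ⋃ i : s, nbrColors f c (C δ) (Order.succ (Ordinal.ToType.toOrd i.1).1) := by
        rintro k ⟨α, e, ξ, h1, h2, h3, h4⟩
        obtain ⟨i, hi, hi'⟩ := hs (Ordinal.ToType.mk ⟨α, h2⟩)
        refine mem_iUnion.2 ⟨⟨i, hi⟩, α, e, ξ, h1, Order.lt_succ_iff.2 ?_, h3, h4⟩
        have := Ordinal.ToType.mk.symm.monotone hi'
        simpa using! this
      refine (mk_le_mk_of_subset this).trans_lt
        ((card_iUnion_lt_iff_forall_of_isRegular hχ (hs' ▸ hcof)).2 fun i => ?_)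
      exact ih' _ (hlim.succ_lt (Ordinal.ToType.toOrd i.1).2)
    · have hxlt : x < δ := hxδ.lt_of_ne fun h => hcof (h ▸ hx h)
      by_cases hub : UnbddBelow (C δ) x
      · have heq := (S.coh δ hδo hδ x hxlt hlim hub).resolve_left hcof
        rw [← nbrColors_inter_Iio, ← heq]
        exact ((hc x hxlt le_rfl).2 hlim).1
      · unfold UnbddBelow at hub
        push Not at hub
        obtain ⟨b, hb, hb'⟩ := hub
        refine (mk_le_mk_of_subset ?_).trans_lt (ih' b hb)
        rintro k ⟨α, e, ξ, h1, h2, h3, h4⟩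
        exact ⟨α, e, ξ, h1, lt_of_not_ge fun h => (hb' α h1.1 h).not_gt h2, h3, h4⟩

end Graph

/-! ### Extending good colorings. -/

theorem exists_rec_eq {X : Type*} (x₀ : X)
    (Φ : Ordinal.{u} → (Ordinal.{u} → X) → X) :
    ∃ F : Ordinal.{u} → X, ∀ β, F β = Φ β fun y => if y < β then F y else x₀ := by
  classical
  let F : Ordinal.{u} → X := (wellFounded_lt (α := Ordinal.{u})).fix
    fun β ih => Φ β fun y => if h : y < β then ih y h else x₀
  refine ⟨F, fun β => ?_⟩
  have := (wellFounded_lt (α := Ordinal.{u})).fix_eq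
    (fun β (ih : ∀ y, y < β → X) => Φ β fun y => if h : y < β then ih y h else x₀) β
  change F β = _ at this
  rw [this]
  rfl

section Graph

variable (f : Ordinal.{u} → Ordinal.{u} → Ordinal.{u}) {K : Type u} {χ : Cardinal.{u}}
  {C : Ordinal.{u} → Set Ordinal.{u}}

theorem mk_range_const_lt (hχ : ℵ₀ ≤ χ) (k : K) :
    #(range fun _ : Ordinal.{u} => k) < χ := by
  rw [range_const, mk_singleton]
  exact one_lt_aleph0.trans_le hχ

/-- Good colorings extend, with a prescribed color on the upper part of the last level. -/
def Extendible (χ : Cardinal.{u}) (C : Ordinal.{u} → Set Ordinal.{u}) (K : Type u)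
    (δ : Ordinal.{u}) : Prop :=
  ∀ ε < δ, ∀ c : Ordinal.{u} → Ordinal.{u} → K, (∀ β ≤ ε, Good f χ C c β) → ∀ j,
    ∃ c' : Ordinal.{u} → Ordinal.{u} → K, (∀ β ≤ ε, c' β = c β) ∧
      (∀ β ≤ δ, Good f χ C c' β) ∧ ∀ η, ε < η → c' δ η = j

variable {f}

/-- Extend to `e` with color `j` on its upper part, then on to `d`; the second extension does not
touch levels up to `e`. -/
theorem Extendible.exists_prescribed {δ : Ordinal.{u}} (H : ∀ δ' < δ, Extendible f χ C K δ')
    {q d e : Ordinal.{u}} {c : Ordinal.{u} → Ordinal.{u} → K} (j : K) (hd : d < δ) (hqd : q < d)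
    (hc : ∀ β ≤ q, Good f χ C c β) :
    ∃ c' : Ordinal.{u} → Ordinal.{u} → K, (∀ β ≤ q, c' β = c β) ∧
      (∀ β ≤ d, Good f χ C c' β) ∧ (q < e → e ≤ d → ∀ ξ, q < ξ → c' e ξ = j) := by
  by_cases he : q < e ∧ e ≤ d
  · obtain ⟨c₁, h1, h2, h3⟩ := H e (he.2.trans_lt hd) q he.1 c hc j
    rcases he.2.lt_or_eq with hlt | rfl
    · obtain ⟨c₂, h4, h5, -⟩ := H d hd e hlt c₁ h2 j
      exact ⟨c₂, fun β hβ => (h4 β (hβ.trans he.1.le)).trans (h1 β hβ), h5,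
        fun _ _ ξ hξ => by rw [h4 e le_rfl, h3 ξ hξ]⟩
    · exact ⟨c₁, h1, h2, fun _ _ => h3⟩
  · obtain ⟨c₁, h1, h2, -⟩ := H d hd q hqd c hc j
    exact ⟨c₁, h1, h2, fun h h' => absurd ⟨h, h'⟩ he⟩

theorem Extendible.of_not_isSuccLimit (hχ : ℵ₀ ≤ χ) {δ : Ordinal.{u}}
    (H : ∀ δ' < δ, Extendible f χ C K δ') (hδ : ¬ Order.IsSuccLimit δ) :
    Extendible f χ C K δ := by
  intro ε hε c hc j
  rcases Ordinal.zero_or_succ_or_isSuccLimit δ with rfl | ⟨y, rfl⟩ | hlim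
  · exact absurd hε not_lt_zero
  · obtain ⟨c₁, h1, h2⟩ : ∃ c₁ : Ordinal.{u} → Ordinal.{u} → K, (∀ β ≤ ε, c₁ β = c β) ∧
        ∀ β ≤ y, Good f χ C c₁ β := by
      rcases (Order.lt_succ_iff.1 hε).lt_or_eq with hlt | rfl
      · obtain ⟨c₁, h1, h2, -⟩ := H y (Order.lt_succ y) ε hlt c hc j
        exact ⟨c₁, h1, h2⟩
      · exact ⟨c, fun _ _ => rfl, hc⟩
    refine ⟨fun β => if β ≤ y then c₁ β else fun _ => j, fun β hβ => ?_, fun β hβ => ?_,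
      fun η _ => ?_⟩
    · simp only [hβ.trans (Order.lt_succ_iff.1 hε), if_true, h1 β hβ]
    · by_cases hβy : β ≤ y
      · exact (h2 β hβy).congr f fun z hz => by simp [hz.trans hβy]
      · obtain rfl : β = Order.succ y := hβ.antisymm (Order.succ_le_of_lt (not_le.1 hβy))
        refine ⟨?_, fun h => absurd h hδ⟩
        simp only [hβy, if_false]
        exact mk_range_const_lt hχ j
    · simp
  · exact absurd hlim hδ

/-- Extend interval by interval along `C δ`, giving every selected level in an interval beyond `ε`
the color `j' ≠ j` on its upper part. Then `j` is safe on level `δ` above `ε`, and the neighbors of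
level `δ` see fewer than `χ` colors, so some color is left for its lower part. -/
theorem Extendible.of_isSuccLimit {o : Ordinal.{u}} (hχ : χ.IsRegular) (hK : #K = χ)
    (S : StarSeq χ o C) {δ : Ordinal.{u}} (hδo : δ < o) (hδ : Order.IsSuccLimit δ)
    (H : ∀ δ' < δ, Extendible f χ C K δ') : Extendible f χ C K δ := by
  classical
  intro ε hε c hc j
  have hinf : Infinite K := infinite_iff.2 (hK ▸ hχ.aleph0_le)
  obtain ⟨j', hj'⟩ := exists_ne j
  set D := C δ with hD
  have hav : ∀ A : Set K, ∃ k, #A < χ → k ∉ A := by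
    intro A
    by_cases hA : A = Set.univ
    · exact ⟨j, fun h => absurd h (by rw [hA, mk_univ, hK]; exact lt_irrefl _)⟩
    · obtain ⟨k, hk⟩ := (ne_univ_iff_exists_notMem A).1 hA
      exact ⟨k, fun _ => hk⟩
  choose av hav using hav
  -- Guarding by the hypotheses makes the extension a total choice function, usable in the recursion
  -- before goodness is known.
  have hg : ∀ (q d e : Ordinal.{u}) (c : Ordinal.{u} → Ordinal.{u} → K),
      ∃ c' : Ordinal.{u} → Ordinal.{u} → K, d < δ → q < d → (∀ β ≤ q, Good f χ C c β) →
        (∀ β ≤ q, c' β = c β) ∧ (∀ β ≤ d, Good f χ C c' β) ∧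
          (q < e → e ≤ d → ∀ ξ, q < ξ → c' e ξ = j') := by
    intro q d e c
    by_cases h : d < δ ∧ q < d ∧ ∀ β ≤ q, Good f χ C c β
    · obtain ⟨c', hc'⟩ := Extendible.exists_prescribed (e := e) H j' h.1 h.2.1 h.2.2
      exact ⟨c', fun _ _ _ => hc'⟩
    · exact ⟨c, fun h1 h2 h3 => absurd ⟨h1, h2, h3⟩ h⟩
  choose g hg using hg
  -- Above `ε`, accumulation points of `D` get one color avoiding their neighbors. Any other `β`
  -- copies the chosen extension from `max (pre D β) ε` to the next point of `D`. Its arguments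
  -- depend only on `D ∩ Iio β` and the truncated coloring, so all levels of one gap above `ε` copy
  -- the same extension.
  obtain ⟨F, hF⟩ := exists_rec_eq (fun _ : Ordinal.{u} => j)
    (fun β (G : Ordinal.{u} → Ordinal.{u} → K) =>
      if β ≤ ε then c β
      else if pre D β = β then fun _ => av (nbrColors f G (C β) β)
      else g (max (pre D β) ε) (sInf (D \ (D ∩ Iio β)))
        (f (pre D β) (sInf (D \ (D ∩ Iio β))))
        (fun y => if y ≤ max (pre D β) ε then G y else fun _ => j) β)
  have F1 : ∀ β ≤ ε, F β = c β := fun β hβ => by rw [hF, if_pos hβ]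
  have F2 : ∀ β, ε < β → pre D β = β → F β = fun _ => av (nbrColors f F (C β) β) := by
    intro β hβ hp
    rw [hF, if_neg hβ.not_ge, if_pos hp]
    rw [nbrColors_congr f (c' := F) (C β) fun y hy => if_pos hy]
  let T : Ordinal.{u} → Ordinal.{u} → Ordinal.{u} → K :=
    fun q y => if y ≤ q then F y else fun _ => j
  have F3 : ∀ β, ε < β → pre D β < β → F β = g (max (pre D β) ε) (sInf (D \ (D ∩ Iio β)))
      (f (pre D β) (sInf (D \ (D ∩ Iio β)))) (T (max (pre D β) ε)) β := by
    intro β hβ hp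
    rw [hF, if_neg hβ.not_ge, if_neg hp.ne]
    congr 1
    funext y
    by_cases hy : y ≤ max (pre D β) ε
    · simp only [T, hy, if_true, hy.trans_lt (max_lt hp hβ)]
    · simp only [T, hy, if_false]
  have TG : ∀ q, (∀ y ≤ q, Good f χ C F y) → ∀ y ≤ q, Good f χ C (T q) y := fun q hq y hy =>
    (hq y hy).congr f fun z hz => (if_pos (hz.trans hy)).symm
  have J : ∀ α e, Nbr f D α e → ε < pre D α → α < δ → (∀ y ≤ pre D α, Good f χ C F y) →
      ∀ ξ, pre D α < ξ → F e ξ = j' := by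
    rintro α e ⟨hα, he, h1, h2⟩ hε' hαδ hgood ξ hξ
    have hI := inter_Iio_eq_of_pre_lt h1 h2
    have hp : pre D e = pre D α := by rw [pre, hI, pre]
    have hs : sInf (D \ (D ∩ Iio e)) = α := by
      rw [hI]
      refine IsLeast.csInf_eq ⟨⟨hα, fun h => lt_irrefl α h.2⟩, fun z hz => ?_⟩
      exact le_of_not_gt fun h => hz.2 ⟨hz.1, h⟩
    rw [F3 e (hε'.trans h1) (hp ▸ h1), hs, hp, max_eq_left hε'.le, ← he]
    exact (hg _ _ _ _ hαδ (h1.trans_le h2) (TG _ hgood)).2.2 h1 h2 ξ hξ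
  -- Three sources of colors: points of `D` up to `ε`, the single interval straddling `ε`, and the
  -- later intervals, which contribute only `j'`.
  have Bd : ∀ x ≤ δ, Order.succ ε < x → (∀ y < x, Good f χ C F y) →
      #(nbrColors f F D x) < χ := by
    intro x hx hεx hgood
    have hA : #(nbrColors f F D (Order.succ ε)) < χ :=
      mk_nbrColors_lt f hχ S hδo hδ _ (hεx.le.trans hx) (fun h => absurd h (hεx.trans_le hx).ne)
        fun β _ hβ => hgood β (hβ.trans_lt hεx)
    have hB : ∃ B : Set K, #B < χ ∧ ∀ α e ξ, Nbr f D α e → ε < α → α < x → pre D α ≤ ε →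
        F e ξ ∈ B := by
      by_cases h : ∃ α e, Nbr f D α e ∧ ε < α ∧ α < x ∧ pre D α ≤ ε
      · obtain ⟨α, e, h1, h2, h3, h4⟩ := h
        refine ⟨range (F e), (hgood e (h1.2.2.2.trans_lt h3)).1, ?_⟩
        intro α' e' ξ h1' h2' h3' h4'
        obtain rfl : α = α' := by
          rcases lt_trichotomy α α' with h | h | h
          · exact absurd ((le_pre h1.1 h).trans h4') h2.not_ge
          · exact h
          · exact absurd ((le_pre h1'.1 h).trans h4) h2'.not_ge
        rw [h1.2.1, ← h1'.2.1]
        exact ⟨ξ, rfl⟩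
      · refine ⟨{j}, ?_, fun α e ξ h1 h2 h3 h4 => absurd ⟨α, e, h1, h2, h3, h4⟩ h⟩
        rw [mk_singleton]
        exact one_lt_aleph0.trans_le hχ.aleph0_le
    obtain ⟨B, hB, hB'⟩ := hB
    have hj1 : #({j'} : Set K) < χ := by
      rw [mk_singleton]
      exact one_lt_aleph0.trans_le hχ.aleph0_le
    refine (mk_le_mk_of_subset ?_).trans_lt
      (mk_union_lt hχ.aleph0_le (mk_union_lt hχ.aleph0_le hA hB) hj1)
    rintro k ⟨α, e, ξ, h1, h2, h3, rfl⟩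
    rcases le_or_gt α ε with h | h
    · exact Or.inl (Or.inl ⟨α, e, ξ, h1, Order.lt_succ_iff.2 h, h3, rfl⟩)
    · rcases le_or_gt (pre D α) ε with h' | h'
      · exact Or.inl (Or.inr (hB' α e ξ h1 h h2 h'))
      · exact Or.inr (J α e h1 h' (h2.trans_le hx)
          (fun y hy => hgood y (hy.trans_lt ((pre_le D α).trans_lt h2))) ξ h3)
  have FG : ∀ β < δ, Good f χ C F β := by
    intro β
    induction β using WellFoundedLT.induction with
    | ind β ih =>
    intro hβδ
    have ih' : ∀ y < β, Good f χ C F y := fun y hy => ih y hy (hy.trans hβδ)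
    rcases le_or_gt β ε with hβ | hβ
    · exact (hc β hβ).congr f fun y hy => (F1 y (hy.trans hβ)).symm
    rcases (pre_le D β).lt_or_eq with hp | hp
    · have hq : max (pre D β) ε < β := max_lt hp hβ
      have hdm : sInf (D \ (D ∩ Iio β)) ∈ D \ (D ∩ Iio β) := by
        refine csInf_mem ?_
        obtain ⟨α, h1, h2, -⟩ := S.unbdd δ hδo hδ β hβδ
        exact ⟨α, h1, fun h => h2.not_gt h.2⟩
      have hd : sInf (D \ (D ∩ Iio β)) < δ := S.sub δ hδo hδ hdm.1
      have hd' : β ≤ sInf (D \ (D ∩ Iio β)) := le_of_not_gt fun h => hdm.2 ⟨hdm.1, h⟩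
      obtain ⟨h1, h2, -⟩ := hg (max (pre D β) ε) (sInf (D \ (D ∩ Iio β)))
        (f (pre D β) (sInf (D \ (D ∩ Iio β)))) (T (max (pre D β) ε)) hd (hq.trans_le hd')
        (TG _ fun y hy => ih' y (hy.trans_lt hq))
      refine (h2 β hd').congr f fun y hy => ?_
      rcases le_or_gt y (max (pre D β) ε) with hy' | hy'
      · rw [h1 y hy']
        exact if_pos hy'
      · obtain ⟨hy1, hy2⟩ := max_lt_iff.1 hy'
        have hI := inter_Iio_eq_of_pre_lt hy1 hy
        have hpy : pre D y = pre D β := by rw [pre, hI, pre]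
        rw [F3 y hy2 (hpy ▸ hy1), hpy, hI]
    · have hub := UnbddBelow.of_pre_eq hp
      have hlim := hub.isSuccLimit hp (bot_le.trans_lt hβ)
      have hN : #(nbrColors f F (C β) β) < χ := by
        -- Small cofinality is handled by counting along `C β`; otherwise `C β` is an initial
        -- segment of `D`, where `Bd` applies.
        rcases S.coh δ hδo hδ β hβδ hlim hub with h | h
        · exact mk_nbrColors_lt f hχ S (hβδ.trans hδo) hlim β le_rfl (fun _ => h)
            fun y hy _ => ih' y hy
        · rw [h, nbrColors_inter_Iio]
          exact Bd β hβδ.le (hlim.succ_lt hβ) ih'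
      rw [Good, F2 β hβ hp]
      refine ⟨mk_range_const_lt hχ.aleph0_le _, fun _ => ⟨hN, ?_⟩⟩
      intro α e ξ η h1 h2 h3 _ h5
      exact hav _ hN ⟨α, e, ξ, h1, h2, h3, h5⟩
  have hN := Bd δ le_rfl (hδ.succ_lt hε) FG
  have hlt : ∀ y < δ, (fun y => if y < δ then F y else
      fun η => if ε < η then j else av (nbrColors f F D δ)) y = F y := fun y hy => if_pos hy
  refine ⟨fun y => if y < δ then F y else
    fun η => if ε < η then j else av (nbrColors f F D δ), fun β hβ => ?_, fun β hβ => ?_,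
    fun η hη => ?_⟩
  · rw [hlt β (hβ.trans_lt hε), F1 β hβ]
  · rcases hβ.lt_or_eq with hβ | rfl
    · exact (FG β hβ).congr f fun y hy => (hlt y (hy.trans_lt hβ)).symm
    · refine ⟨?_, fun _ => ⟨?_, ?_⟩⟩
      · refine (mk_le_mk_of_subset (t := {j} ∪ {av (nbrColors f F D β)}) ?_).trans_lt
          (mk_union_lt hχ.aleph0_le ?_ ?_)
        · rintro _ ⟨η, rfl⟩
          simp only [lt_irrefl, if_false]
          split_ifs
          · exact Or.inl rfl
          · exact Or.inr rfl
        all_goals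
          rw [mk_singleton]
          exact one_lt_aleph0.trans_le hχ.aleph0_le
      · rwa [nbrColors_congr f _ hlt]
      · intro α e ξ η h1 h2 h3 h4 h5
        rw [hlt e (h1.2.2.2.trans_lt h2)] at h5
        simp only [lt_irrefl, if_false] at h5
        -- For `η > ε` the neighbor's interval starts above `ε`, so its color is `j'`, not `j`; for
        -- `η ≤ ε` the color was chosen outside all neighbor colors.
        split_ifs at h5 with h
        · rw [J α e h1 (h.trans_le h4) h2
            (fun y hy => FG y (hy.trans_lt ((pre_le D α).trans_lt h2))) ξ h3] at h5
          exact hj' h5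
        · exact hav _ hN ⟨α, e, ξ, h1, h2, h3, h5⟩
  · simp [hη]

theorem extendible {o : Ordinal.{u}} (hχ : χ.IsRegular) (hK : #K = χ) (S : StarSeq χ o C)
    (δ : Ordinal.{u}) (hδo : δ < o) : Extendible f χ C K δ := by
  induction δ using WellFoundedLT.induction with
  | ind δ ih =>
  have H : ∀ δ' < δ, Extendible f χ C K δ' := fun δ' h => ih δ' h (h.trans hδo)
  by_cases hδ : Order.IsSuccLimit δ
  · exact .of_isSuccLimit hχ hK S hδo hδ H
  · exact .of_not_isSuccLimit hχ.aleph0_le H hδ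

/-- Below any level there is a coloring which is good at all levels. -/
theorem exists_good {o : Ordinal.{u}} (hχ : χ.IsRegular) (hK : #K = χ) (S : StarSeq χ o C)
    (δ : Ordinal.{u}) (hδo : δ < o) :
    ∃ c : Ordinal.{u} → Ordinal.{u} → K, ∀ β ≤ δ, Good f χ C c β := by
  have : Infinite K := infinite_iff.2 (hK ▸ hχ.aleph0_le)
  obtain ⟨j⟩ : Nonempty K := inferInstance
  have h0 : ∀ β ≤ (0 : Ordinal.{u}), Good f χ C (fun _ _ => j) β := fun β hβ => by
    obtain rfl := le_antisymm hβ bot_le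
    exact ⟨mk_range_const_lt hχ.aleph0_le j, fun h => absurd isMin_bot h.1⟩
  rcases eq_or_ne δ 0 with rfl | hδ
  · exact ⟨_, h0⟩
  · obtain ⟨c, -, hc, -⟩ :=
      extendible (f := f) hχ hK S δ hδo 0 (bot_lt_iff_ne_bot.2 hδ) _ h0 j
    exact ⟨c, hc⟩

end Graph

/-! ### The graph -/

section Graph

variable (f : Ordinal.{u} → Ordinal.{u} → Ordinal.{u}) (C : Ordinal.{u} → Set Ordinal.{u})

/-- `(e, ξ)` is a lower neighbor of `(δ, η)`. -/
def Edge (δ η e ξ : Ordinal.{u}) : Prop :=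
  Order.IsSuccLimit δ ∧ ∃ α, Nbr f (C δ) α e ∧ α < δ ∧ η ≤ pre (C δ) α ∧ pre (C δ) α < ξ

theorem Edge.lt {f : Ordinal.{u} → Ordinal.{u} → Ordinal.{u}} {C : Ordinal.{u} → Set Ordinal.{u}}
    {δ η e ξ : Ordinal.{u}} (h : Edge f C δ η e ξ) : e < δ := by
  obtain ⟨-, α, h1, h2, -⟩ := h
  exact h1.2.2.2.trans_lt h2

/-- The graph on pairs of ordinals below `o` given by the lower neighbors. -/
def graph (o : Ordinal.{u}) : SimpleGraph (o.ToType × o.ToType) where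
  Adj p q := Edge f C p.1.toOrd p.2.toOrd q.1.toOrd q.2.toOrd ∨
    Edge f C q.1.toOrd q.2.toOrd p.1.toOrd p.2.toOrd
  symm := ⟨fun _ _ h => h.symm⟩
  loopless := ⟨fun _ h => h.elim (fun h => lt_irrefl _ h.lt) fun h => lt_irrefl _ h.lt⟩

theorem mk_graph_verts {κ : Cardinal.{u}} (hκ : ℵ₀ ≤ κ) :
    #(κ.ord.ToType × κ.ord.ToType) = κ := by
  simp [mul_eq_self hκ]

theorem chr_le_of_coloring {V K : Type u} {G : SimpleGraph V} (c : G.Coloring K) :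
    chr G ≤ #K :=
  csInf_le' ⟨K, rfl, ⟨c⟩⟩

theorem exists_coloring_chr {V : Type u} (G : SimpleGraph V) :
    ∃ K : Type u, #K = chr G ∧ Nonempty (G.Coloring K) :=
  csInf_mem (s := {μ | ∃ K : Type u, #K = μ ∧ Nonempty (G.Coloring K)})
    ⟨#V, V, rfl, ⟨G.selfColoring⟩⟩

variable {f C}

/-! ### Small subgraphs are `χ`-colorable. -/

theorem chr_subgraph_le {χ κ : Cardinal.{u}} (hχ : χ.IsRegular) (hκ : κ.IsRegular)
    (S : StarSeq χ κ.ord C) (H : (graph f C κ.ord).Subgraph)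
    (hH : #H.verts < #(κ.ord.ToType × κ.ord.ToType)) : chr H.coe ≤ χ := by
  rw [mk_graph_verts hκ.aleph0_le] at hH
  obtain ⟨δ, hδ⟩ : ∃ δ : κ.ord.ToType, ∀ p ∈ H.verts, p.1 < δ := by
    have : ¬ IsCofinal (Prod.fst '' H.verts) := by
      intro hcof
      have := (Order.cof_le hcof).trans mk_image_le
      rw [Ordinal.cof_toType, hκ.cof_ord] at this
      exact this.not_gt hH
    obtain ⟨δ, hδ⟩ := not_isCofinal_iff.1 this
    exact ⟨δ, fun p hp => by simpa using hδ p.1 ⟨p, hp, rfl⟩⟩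
  obtain ⟨c, hc⟩ := exists_good (f := f) hχ (mk_ord_toType χ) S δ.toOrd.1 δ.toOrd.2
  have key : ∀ p q : κ.ord.ToType × κ.ord.ToType, p ∈ H.verts →
      Edge f C p.1.toOrd p.2.toOrd q.1.toOrd q.2.toOrd →
      c q.1.toOrd q.2.toOrd ≠ c p.1.toOrd p.2.toOrd := by
    rintro p q hp ⟨hlim, α, h1, h2, h3, h4⟩
    have : p.1.toOrd.1 ≤ δ.toOrd.1 := Ordinal.ToType.mk.symm.monotone (hδ p hp).le
    exact ((hc _ this).2 hlim).2 α _ _ _ h1 h2 h4 h3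
  rw [← mk_ord_toType χ]
  refine chr_le_of_coloring (SimpleGraph.Coloring.mk
    (fun v : H.verts => c v.1.1.toOrd v.1.2.toOrd) fun {v w} hvw => ?_)
  rcases H.adj_sub hvw with h | h
  · exact (key v.1 w.1 v.2 h).symm
  · exact key w.1 v.1 w.2 h

/-! ### The lower bound for the chromatic number. -/

/-- The guessing property making the chromatic number of the graph exceed `θ`. -/
def Guesses (f : Ordinal.{u} → Ordinal.{u} → Ordinal.{u}) (C : Ordinal.{u} → Set Ordinal.{u})
    (κ θ : Cardinal.{u}) : Prop :=
  ∀ A : Ordinal.{u} → Set Ordinal.{u}, (∀ i < θ.ord, CofinalIn (A i) κ) →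
    ∀ ζ < κ.ord, ∃ δ, ζ < δ ∧ δ < κ.ord ∧ Order.IsSuccLimit δ ∧ ∀ i < θ.ord, ∀ η < δ,
      ∃ α e, Nbr f (C δ) α e ∧ α < δ ∧ η ≤ pre (C δ) α ∧ e ∈ A i ∧
        ∃ γ ∈ A i, pre (C δ) α ≤ γ ∧ γ < e

/-- The supremum of the iterates `g^[n] β` stays below `κ` because `κ` is regular and uncountable.
No monotonicity of `g` is needed: the iterates themselves serve as the points `y`. -/
theorem exists_closed {κ : Cardinal.{u}} (hκ : κ.IsRegular) (hκ' : ℵ₀ < κ)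
    {g : Ordinal.{u} → Ordinal.{u}} (hg : ∀ β < κ.ord, β < g β ∧ g β < κ.ord) {β : Ordinal.{u}}
    (hβ : β < κ.ord) :
    ∃ x < κ.ord, β < x ∧ ∀ b < x, ∃ y, b < y ∧ y < κ.ord ∧ g y < x := by
  have hit : ∀ n : ℕ, g^[n] β < κ.ord := by
    intro n
    induction n with
    | zero => exact hβ
    | succ n ih =>
      rw [Function.iterate_succ_apply']
      exact (hg _ ih).2
  have hstep : ∀ n : ℕ, g^[n] β < g^[n + 1] β := fun n => by
    rw [Function.iterate_succ_apply']
    exact (hg _ (hit n)).1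
  refine ⟨Ordinal.nfp g β, nfp_lt_ord_of_isRegular hκ hκ'.ne' (fun b hb => (hg b hb).2) hβ,
    (hstep 0).trans_le (Ordinal.iterate_le_nfp g β 1), fun b hb => ?_⟩
  obtain ⟨n, hn⟩ := Ordinal.lt_nfp_iff.1 hb
  refine ⟨g^[n] β, hn, hit n, ?_⟩
  rw [← Function.iterate_succ_apply' g]
  exact (hstep (n + 1)).trans_le (Ordinal.iterate_le_nfp g β _)

/-- A property of pairs holding unboundedly often has a cofinal set of points, any two of which are
separated by a witness. -/
theorem exists_cofinal_separated {κ : Cardinal.{u}} (hκ : κ.IsRegular) (hκ' : ℵ₀ < κ)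
    (P : Ordinal.{u} → Ordinal.{u} → Prop)
    (hP : ∀ η < κ.ord, ∃ α ξ, η < α ∧ η < ξ ∧ α < κ.ord ∧ ξ < κ.ord ∧ P α ξ) :
    ∃ A, CofinalIn A κ ∧ ∀ γ ∈ A, ∀ α ∈ A, γ < α → ∃ ξ, γ < ξ ∧ ξ < κ.ord ∧ P α ξ := by
  let B : Ordinal.{u} → Set Ordinal.{u} :=
    fun η => {α | ∃ ξ, η < α ∧ η < ξ ∧ α < κ.ord ∧ ξ < κ.ord ∧ P α ξ}
  let a : Ordinal.{u} → Ordinal.{u} := fun η => sInf (B η)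
  have ha : ∀ η < κ.ord, a η ∈ B η := fun η hη => csInf_mem (hP η hη)
  have hmono : ∀ η η', η ≤ η' → η' < κ.ord → a η ≤ a η' := by
    intro η η' h h'
    obtain ⟨ξ, h1, h2, h3⟩ := ha η' h'
    exact csInf_le' ⟨ξ, h.trans_lt h1, h.trans_lt h2, h3⟩
  -- Only values at closure points `e` of `a` are kept: an earlier value is then below `e`, while `a
  -- e` has a witness `ξ` above `e`.
  refine ⟨{α | ∃ e < κ.ord, (∀ γ < e, a γ < e) ∧ α = a e}, ⟨?_, ?_⟩, ?_⟩
  · rintro α ⟨e, he, -, rfl⟩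
    obtain ⟨ξ, h1, h2, h3, -⟩ := ha e he
    exact h3
  · intro β hβ
    obtain ⟨x, hx, hβx, hcl⟩ := exists_closed hκ hκ' (g := a) (fun b hb => by
      obtain ⟨ξ, h1, h2, h3, -⟩ := ha b hb
      exact ⟨h1, h3⟩) hβ
    refine ⟨a x, ⟨x, hx, fun γ hγ => ?_, rfl⟩, ?_⟩
    · obtain ⟨y, h1, h2, h3⟩ := hcl γ hγ
      exact (hmono γ y h1.le h2).trans_lt h3
    · obtain ⟨ξ, h1, -⟩ := ha x hx
      exact (hβx.trans h1).le
  · rintro _ ⟨e', he', -, rfl⟩ _ ⟨e, he, hcl, rfl⟩ hlt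
    have hee : e' < e := lt_of_not_ge fun h => (hmono e e' h he').not_gt hlt
    obtain ⟨ξ, h1, h2, h3, h4, h5⟩ := ha e he
    exact ⟨ξ, (hcl e' hee).trans h2, h4, h5⟩

theorem Guesses.not_proper {κ θ : Cardinal.{u}} (hκ : κ.IsRegular) (hκ' : ℵ₀ < κ) (hθ : θ < κ)
    (hC : Guesses f C κ θ) (c : Ordinal.{u} → Ordinal.{u} → Ordinal.{u})
    (hc : ∀ δ < κ.ord, ∀ η < κ.ord, c δ η < θ.ord) :
    ∃ δ η e ξ, δ < κ.ord ∧ η < κ.ord ∧ e < κ.ord ∧ ξ < κ.ord ∧ Edge f C δ η e ξ ∧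
      c δ η = c e ξ := by
  classical
  let Bdd : Ordinal.{u} → Ordinal.{u} → Prop := fun i η =>
    ∀ α ξ, η < α → η < ξ → α < κ.ord → ξ < κ.ord → c α ξ ≠ i
  have hb : ∀ i, ∃ b < κ.ord, (∃ η < κ.ord, Bdd i η) → Bdd i b := by
    intro i
    by_cases h : ∃ η < κ.ord, Bdd i η
    · obtain ⟨η, h1, h2⟩ := h
      exact ⟨η, h1, fun _ => h2⟩
    · exact ⟨0, hκ.ord_pos, fun h' => absurd h' h⟩
  choose b hb hb' using hb
  have hA : ∀ i, ∃ A, CofinalIn A κ ∧ ((¬ ∃ η < κ.ord, Bdd i η) →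
      ∀ γ ∈ A, ∀ α ∈ A, γ < α → ∃ ξ, γ < ξ ∧ ξ < κ.ord ∧ c α ξ = i) := by
    intro i
    by_cases h : ∃ η < κ.ord, Bdd i η
    · exact ⟨Iio κ.ord, ⟨subset_rfl, fun β hβ => ⟨β, hβ, le_rfl⟩⟩, fun h' => absurd h h'⟩
    · obtain ⟨A, h1, h2⟩ := exists_cofinal_separated hκ hκ' (fun α ξ => c α ξ = i) (by
        intro η hη
        by_contra hcon
        exact h ⟨η, hη, fun α ξ h1 h2 h3 h4 h5 => hcon ⟨α, ξ, h1, h2, h3, h4, h5⟩⟩)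
      exact ⟨A, h1, fun _ => h2⟩
  choose A hA hA' using hA
  let ζ : Ordinal.{u} := ⨆ i : θ.ord.ToType, b i.toOrd
  have hζ : ζ < κ.ord := Ordinal.iSup_lt_of_lt_cof (by simpa [hκ.cof_ord] using hθ) fun i => hb _
  obtain ⟨δ, hζδ, hδ, hlim, hguess⟩ := hC A (fun i _ => hA i) ζ hζ
  have hη : Order.succ ζ < δ := hlim.succ_lt hζδ
  -- The vertex `(δ, ζ + 1)` exceeds every bound `b i` in both coordinates, so its color must be an
  -- unbounded one.
  have hi := hc δ hδ _ (hη.trans hδ)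
  obtain ⟨α, e, h1, h2, h3, h4, γ, h5, h6, h7⟩ := hguess _ hi _ hη
  have hbad : ¬ ∃ η < κ.ord, Bdd (c δ (Order.succ ζ)) η := by
    intro h
    have hle : b (c δ (Order.succ ζ)) ≤ ζ := by
      have := Ordinal.le_iSup (fun i : θ.ord.ToType => b i.toOrd)
        (Ordinal.ToType.mk ⟨c δ (Order.succ ζ), hi⟩)
      simpa using this
    exact hb' _ h δ (Order.succ ζ) (hle.trans_lt hζδ) (hle.trans_lt (Order.lt_succ ζ)) hδ
      (hη.trans hδ) rfl
  obtain ⟨ξ, h8, h9, h10⟩ := hA' _ hbad γ h5 e h4 h7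
  exact ⟨δ, Order.succ ζ, e, ξ, hδ, hη.trans hδ, (hA _).1 h4, h9,
    ⟨hlim, α, h1, h2, h3, h6.trans_lt h8⟩, h10.symm⟩

theorem Guesses.lt_chr {κ θ : Cardinal.{u}} (hκ : κ.IsRegular) (hκ' : ℵ₀ < κ) (hθ : θ < κ)
    (hC : Guesses f C κ θ) : θ < chr (graph f C κ.ord) := by
  classical
  by_contra! hle
  obtain ⟨K, hK, ⟨c⟩⟩ := exists_coloring_chr (graph f C κ.ord)
  obtain ⟨j⟩ : Nonempty (K ↪ θ.ord.ToType) := by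
    rw [← le_def, mk_ord_toType, hK]
    exact hle
  obtain ⟨δ, η, e, ξ, h1, h2, h3, h4, h5, h6⟩ := hC.not_proper hκ hκ' hθ
    (fun δ η => if h : δ < κ.ord ∧ η < κ.ord then
      (j (c (Ordinal.ToType.mk ⟨δ, h.1⟩, Ordinal.ToType.mk ⟨η, h.2⟩))).toOrd else 0) (by
      intro δ h1 η h2
      simp only [h1, h2, and_self, dite_true]
      exact (j _).toOrd.2)
  simp only [h1, h2, h3, h4, and_self, dite_true] at h6
  have h7 := j.injective (Ordinal.ToType.mk.symm.injective (Subtype.ext h6))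
  refine c.valid (v := (Ordinal.ToType.mk ⟨δ, h1⟩, Ordinal.ToType.mk ⟨η, h2⟩))
    (w := (Ordinal.ToType.mk ⟨e, h3⟩, Ordinal.ToType.mk ⟨ξ, h4⟩)) ?_ h7
  left
  simpa using h5

theorem exists_isChromaticGT {χ κ θ : Cardinal.{u}} (hχ : χ.IsRegular) (hκ : κ.IsRegular)
    (hχκ : χ < κ) (hθκ : θ < κ) (hχθ : χ ≤ θ) (S : StarSeq χ κ.ord C) (hC : Guesses f C κ θ) :
    ∃ (V : Type u) (G : SimpleGraph V), #V = κ ∧ IsChromaticGT G χ θ := by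
  have h := hC.lt_chr hκ (hχ.aleph0_le.trans_lt hχκ) hθκ
  exact ⟨_, graph f C κ.ord, mk_graph_verts hκ.aleph0_le, _, h, hχθ.trans h.le, rfl,
    fun H hH => chr_subgraph_le hχ hκ S H hH⟩

theorem exists_isChromatic {χ κ : Cardinal.{u}} (hχ : χ.IsRegular) (hκ : κ.IsRegular)
    (hχκ : χ < κ) (S : StarSeq χ κ.ord C) (hC : ∀ θ < κ, Guesses f C κ θ) :
    ∃ (V : Type u) (G : SimpleGraph V), #V = κ ∧ IsChromatic G χ κ := by
  have hle : chr (graph f C κ.ord) ≤ κ := by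
    have := chr_le_of_coloring (graph f C κ.ord).selfColoring
    rwa [mk_graph_verts hκ.aleph0_le] at this
  refine ⟨_, graph f C κ.ord, mk_graph_verts hκ.aleph0_le, hχκ.le,
    hle.antisymm (le_of_not_gt fun h => ?_), fun H hH => chr_subgraph_le hχ hκ S H hH⟩
  -- Guessing with `θ` equal to the chromatic number itself would make that number exceed itself.
  exact lt_irrefl _ ((hC _ h).lt_chr hκ (hχ.aleph0_le.trans_lt hχκ) h)

end Graph

/-! ### The degenerate case `θ < χ`. -/

/-- A complete graph on `χ` many vertices together with isolated vertices. -/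
theorem exists_isChromaticGT_of_lt {χ κ θ : Cardinal.{u}} (hχκ : χ < κ) (hθ : θ < χ) :
    ∃ (V : Type u) (G : SimpleGraph V), #V = κ ∧ IsChromaticGT G χ θ := by
  classical
  obtain ⟨s, hs⟩ : ∃ s : Set κ.ord.ToType, #s = χ :=
    le_mk_iff_exists_set.1 (by rw [mk_ord_toType]; exact hχκ.le)
  let G : SimpleGraph κ.ord.ToType :=
    { Adj := fun x y => x ≠ y ∧ x ∈ s ∧ y ∈ s
      symm := ⟨fun _ _ h => ⟨h.1.symm, h.2.2, h.2.1⟩⟩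
      loopless := ⟨fun _ h => h.1 rfl⟩ }
  obtain ⟨k⟩ : Nonempty s := by
    rw [← mk_ne_zero_iff, hs]
    exact (bot_le.trans_lt hθ).ne'
  let c : G.Coloring s := SimpleGraph.Coloring.mk (fun x => if h : x ∈ s then ⟨x, h⟩ else k)
    fun {v w} h => by
      simp only [h.2.1, h.2.2, dite_true, ne_eq, Subtype.mk.injEq]
      exact h.1
  have hle : chr G ≤ χ := hs ▸ chr_le_of_coloring c
  have hge : χ ≤ chr G := by
    obtain ⟨K, hK, ⟨c⟩⟩ := exists_coloring_chr G
    rw [← hK, ← hs]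
    refine mk_le_of_injective (f := fun x : s => c x.1) fun x y hxy => ?_
    by_contra hne
    exact c.valid (v := x.1) (w := y.1) ⟨fun h => hne (Subtype.ext h), x.2, y.2⟩ hxy
  refine ⟨_, G, mk_ord_toType κ, χ, hθ, le_rfl, hle.antisymm hge, fun H _ => ?_⟩
  rw [← hs]
  exact chr_le_of_coloring (SimpleGraph.Coloring.mk (fun v : H.verts => c v.1)
    fun {v w} h => c.valid (H.adj_sub h))

/-! ### Consequences of the proxy principles -/

theorem IsClubIn.unbddBelow {D : Set Ordinal.{u}} {δ : Ordinal.{u}} (h : IsClubIn D δ) :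
    UnbddBelow D δ := by
  intro b hb
  obtain ⟨α, hα, hle⟩ := h.2.isCofinal ⟨b, hb⟩
  exact ⟨α, hα, hle, α.2⟩

theorem IsClubIn.mem_of_unbddBelow {D : Set Ordinal.{u}} {δ x : Ordinal.{u}} (h : IsClubIn D δ)
    (hx : x < δ) (hlim : Order.IsSuccLimit x) (hub : UnbddBelow D x) : x ∈ D := by
  refine h.2.isLUB_mem (t := {y : Iio δ | (y : Ordinal.{u}) ∈ D ∧ (y : Ordinal.{u}) < x})
    (x := ⟨x, hx⟩) (fun y hy => hy.1) ?_ ⟨fun y hy => hy.2.le, fun y hy => ?_⟩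
  · obtain ⟨α, h1, -, h2⟩ := hub 0 (bot_lt_iff_ne_bot.2 hlim.ne_bot)
    exact ⟨⟨α, h2.trans hx⟩, h1, h2⟩
  · by_contra hlt
    have hlt' : (y : Ordinal.{u}) < x := not_le.1 hlt
    obtain ⟨α, h1, h2, h3⟩ := hub _ (hlim.succ_lt hlt')
    have := hy (show (⟨α, h3.trans hx⟩ : Iio δ) ∈ _ from ⟨h1, h3⟩)
    exact (Order.lt_succ (y : Ordinal.{u})).not_ge (h2.trans this)

theorem UnbddBelow.cof_lt {D : Set Ordinal.{u}} {x : Ordinal.{u}} {χ : Cardinal.{u}}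
    (h : UnbddBelow D x) (hD : otp D < Ordinal.lift.{u + 1} χ.ord) : x.cof < χ := by
  have hcof : IsCofinal {y : Iio x | (y : Ordinal.{u}) ∈ D} := fun b => by
    obtain ⟨α, h1, h2, h3⟩ := h b b.2
    exact ⟨⟨α, h3⟩, h1, h2⟩
  have h1 := Order.cof_le hcof
  rw [Ordinal.cof_Iio, ← Ordinal.lift_cof] at h1
  have h2 : #{y : Iio x | (y : Ordinal.{u}) ∈ D} ≤ #D :=
    mk_le_of_injective (f := fun y => (⟨y.1.1, y.2⟩ : D)) fun y z hyz => by
      simpa [Subtype.ext_iff] using hyz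
  rw [lift_ord, lt_ord, otp, Ordinal.card_type] at hD
  exact lift_lt.1 ((h1.trans h2).trans_lt hD)

theorem InitSeg.eq_inter {D E : Set Ordinal.{u}} {x : Ordinal.{u}} (h : InitSeg D E)
    (hD : D ⊆ Iio x) (hub : UnbddBelow D x) : D = E ∩ Iio x := by
  obtain ⟨b, rfl⟩ := h
  rcases le_or_gt x b with hb | hb
  · refine Subset.antisymm (fun y hy => ⟨hy.1, hD hy⟩) fun y hy => ⟨hy.1, hy.2.trans_le hb⟩
  · obtain ⟨α, h1, h2, -⟩ := hub b hb
    exact absurd h1.2 h2.not_gt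

theorem StarSeq.of_initSegStar {χ : Cardinal.{u}} {o : Ordinal.{u}}
    {C : Ordinal.{u} → Set Ordinal.{u}}
    (h1 : ∀ α < o, Order.IsSuccLimit α → IsClubIn (C α) α)
    (h2 : ∀ α < o, Order.IsSuccLimit α → ∀ β ∈ acc (C α), InitSegStar χ (C β) (C α)) :
    StarSeq χ o C where
  sub δ hδ hlim := (h1 δ hδ hlim).1
  unbdd δ hδ hlim := (h1 δ hδ hlim).unbddBelow
  closed δ hδ hlim x hx hxlim hub := (h1 δ hδ hlim).mem_of_unbddBelow hx hxlim hub
  coh δ hδ hlim x hx hxlim hub := by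
    have hC := h1 x (hx.trans hδ) hxlim
    rcases h2 δ hδ hlim x ⟨(h1 δ hδ hlim).mem_of_unbddBelow hx hxlim hub, hub.pre_eq hxlim,
      bot_lt_iff_ne_bot.2 hxlim.ne_bot⟩ with h | h
    · exact Or.inr (h.eq_inter hC.1 hC.unbddBelow)
    · have : sSup (C x) = x := by
        have := hC.unbddBelow.pre_eq hxlim
        rwa [pre, inter_eq_left.2 hC.1] at this
      exact Or.inl (this ▸ h)

/-- In the second alternative `C α` has fewer than `χ` elements, and those below an accumulation
point `β` are cofinal in `β`, so `cf β < χ`. -/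
theorem InitSegSub.initSegStar {χ : Cardinal.{u}} {o : Ordinal.{u}}
    {C : Ordinal.{u} → Set Ordinal.{u}}
    (h1 : ∀ α < o, Order.IsSuccLimit α → IsClubIn (C α) α)
    (h2 : ∀ α < o, Order.IsSuccLimit α → ∀ β ∈ acc (C α), InitSegSub χ (C β) (C α)) :
    ∀ α < o, Order.IsSuccLimit α → ∀ β ∈ acc (C α), InitSegStar χ (C β) (C α) := by
  intro α hα hlim β hβ
  rcases h2 α hα hlim β hβ with h | h
  · exact Or.inl h
  · have hub : UnbddBelow (C α) β := UnbddBelow.of_pre_eq hβ.2.1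
    have hβlim := hub.isSuccLimit hβ.2.1 hβ.2.2
    have hC := h1 β (((h1 α hα hlim).1 hβ.1).trans hα) hβlim
    have : sSup (C β) = β := by
      have := hC.unbddBelow.pre_eq hβlim
      rwa [pre, inter_eq_left.2 hC.1] at this
    refine Or.inr ?_
    rw [this]
    exact hub.cof_lt h.1

theorem ProxyMinus.mono {κ θ : Cardinal.{u}} {σ : Ordinal.{u}} {χ : Cardinal.{u}}
    {S : Set Ordinal.{u}} (hS : S ⊆ Iio κ.ord)
    (h : ProxyMinus κ (InitSegStar χ) θ {S} σ) :
    ProxyMinus κ (InitSegStar χ) θ {Iio κ.ord} σ := by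
  obtain ⟨C, h1, h2, h3⟩ := h
  refine ⟨C, h1, h2, fun A hA T hT => ?_⟩
  rw [mem_singleton_iff.1 hT]
  exact (h3 A hA S rfl).mono fun x hx => ⟨hS hx.1, hx.2⟩

theorem ProxyMinus.initSegStar {κ θ : Cardinal.{u}} {σ : Ordinal.{u}} {χ : Cardinal.{u}}
    {𝒮 : Set (Set Ordinal.{u})} (h : ProxyMinus κ (InitSegSub χ) θ 𝒮 σ) :
    ProxyMinus κ (InitSegStar χ) θ 𝒮 σ := by
  obtain ⟨C, h1, h2, h3⟩ := h
  exact ⟨C, h1, InitSegSub.initSegStar h1 h2, h3⟩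

/-! ### Stationary sets and limit points. -/

/-- The limit points above `ζ` of a cofinal set form a club. -/
theorem isClub_limitPoints {κ : Cardinal.{u}} (hκ : κ.IsRegular) (hκ' : ℵ₀ < κ)
    {A : Set Ordinal.{u}} (hA : CofinalIn A κ) {ζ : Ordinal.{u}} (hζ : ζ < κ.ord) :
    IsClub {x : Iio κ.ord | ζ < (x : Ordinal.{u}) ∧
      ∀ b < (x : Ordinal.{u}), ∃ α ∈ A, b < α ∧ α < x} := by
  refine ⟨fun d hd hne _ a ha => ⟨?_, fun b hb => ?_⟩, fun β => ?_⟩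
  · obtain ⟨y, hy⟩ := hne
    exact (hd hy).1.trans_le (ha.1 hy)
  · obtain ⟨y, hy, hby⟩ :=
      (lt_isLUB_iff ha (b := (⟨b, lt_trans hb a.2⟩ : Iio κ.ord))).1 hb
    obtain ⟨α, h1, h2, h3⟩ := (hd hy).2 b hby
    exact ⟨α, h1, h2, h3.trans_le (ha.1 hy)⟩
  · have hlim : Order.IsSuccLimit κ.ord := isSuccLimit_ord hκ.aleph0_le
    have hne : ∀ b < κ.ord, (A ∩ Ioi b).Nonempty := fun b hb => by
      obtain ⟨α, h1, h2⟩ := hA.2 _ (hlim.succ_lt hb)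
      exact ⟨α, h1, (Order.lt_succ b).trans_le h2⟩
    obtain ⟨x, hx, hβx, hcl⟩ := exists_closed hκ hκ' (g := fun b => sInf (A ∩ Ioi b))
      (fun b hb => ⟨(csInf_mem (hne b hb)).2, hA.1 (csInf_mem (hne b hb)).1⟩)
      (max_lt β.2 hζ)
    refine ⟨⟨x, hx⟩, ⟨(le_max_right _ _).trans_lt hβx, fun b hb => ?_⟩,
      ((le_max_left _ _).trans_lt hβx).le⟩
    obtain ⟨y, h1, h2, h3⟩ := hcl b hb
    exact ⟨_, (csInf_mem (hne y h2)).1, h1.trans (csInf_mem (hne y h2)).2, h3⟩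

theorem StationaryIn.exists_limitPoint {κ : Cardinal.{u}} (hκ : κ.IsRegular) (hκ' : ℵ₀ < κ)
    {T A : Set Ordinal.{u}} (hT : StationaryIn T κ) (hA : CofinalIn A κ) {ζ : Ordinal.{u}}
    (hζ : ζ < κ.ord) :
    ∃ δ ∈ T, ζ < δ ∧ δ < κ.ord ∧ ∀ b < δ, ∃ α ∈ A, b < α ∧ α < δ := by
  obtain ⟨x, hx, hx'⟩ := hT (isClub_limitPoints hκ hκ' hA hζ)
  exact ⟨x, hx, hx'.1, x.2, hx'.2⟩

theorem StationaryIn.exists_isSuccLimit {κ : Cardinal.{u}} (hκ : κ.IsRegular) (hκ' : ℵ₀ < κ)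
    {T : Set Ordinal.{u}} (hT : StationaryIn T κ) {ζ : Ordinal.{u}} (hζ : ζ < κ.ord) :
    ∃ δ ∈ T, ζ < δ ∧ δ < κ.ord ∧ Order.IsSuccLimit δ := by
  obtain ⟨δ, h1, h2, h3, h4⟩ := hT.exists_limitPoint hκ hκ'
    (A := Iio κ.ord) ⟨subset_rfl, fun β hβ => ⟨β, hβ, le_rfl⟩⟩ hζ
  refine ⟨δ, h1, h2, h3, ?_⟩
  rcases Ordinal.zero_or_succ_or_isSuccLimit δ with rfl | ⟨y, rfl⟩ | h
  · exact absurd h2 not_lt_zero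
  · obtain ⟨α, -, h5, h6⟩ := h4 y (Order.lt_succ y)
    exact absurd (Order.lt_succ_iff.1 h6) h5.not_ge
  · exact h

/-! ### Successive elements of a set of ordinals. -/

theorem otp_inter_Iio_lt {D : Set Ordinal.{u}} {x : Ordinal.{u}} (hx : x ∈ D) :
    otp (D ∩ Iio x) < otp D := by
  refine (?_ : otp (D ∩ Iio x) = Ordinal.typein (fun a b : D => a < b) ⟨x, hx⟩).trans_lt
    (Ordinal.typein_lt_type _ _)
  refine Ordinal.type_eq.2 ⟨⟨⟨fun y => ⟨⟨y.1, y.2.1⟩, y.2.2⟩, fun y => ⟨y.1.1, y.1.2, y.2⟩,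
    fun y => rfl, fun y => rfl⟩, Iff.rfl⟩⟩

/-- The least element of `D` above `β`. -/
noncomputable def next (D : Set Ordinal.{u}) (β : Ordinal.{u}) : Ordinal.{u} :=
  sInf (D ∩ Ioi β)

theorem UnbddBelow.next_mem {D : Set Ordinal.{u}} {δ β : Ordinal.{u}} (hD : UnbddBelow D δ)
    (hδ : Order.IsSuccLimit δ) (hβ : β < δ) : next D β ∈ D ∧ β < next D β := by
  obtain ⟨α, h1, h2, -⟩ := hD _ (hδ.succ_lt hβ)
  exact csInf_mem (s := D ∩ Ioi β) ⟨α, h1, (Order.lt_succ β).trans_le h2⟩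

theorem le_of_lt_next {D : Set Ordinal.{u}} {β y : Ordinal.{u}} (hy : y ∈ D) (h : y < next D β) :
    y ≤ β :=
  le_of_not_gt fun h' => h.not_ge (csInf_le' ⟨hy, h'⟩)

theorem pre_next {D : Set Ordinal.{u}} {β : Ordinal.{u}} (hβ : β ∈ D) (h : β < next D β) :
    pre D (next D β) = β :=
  (csSup_le' fun _ hy => le_of_lt_next hy.1 hy.2).antisymm (le_pre hβ h)

theorem next_mem_suc {D : Set Ordinal.{u}} {β σ : Ordinal.{u}} (hσ : 0 < σ) (hβ : β ∈ D)
    (h : next D β ∈ D) (h' : β < next D β) : next D β ∈ suc σ (D \ Iio β) := by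
  have hmem : next D β ∈ D \ Iio β := ⟨h, h'.not_gt⟩
  have hnth : otp ((D \ Iio β) ∩ Iio (next D β)) = Ordinal.lift.{u + 1, u} (0 + 1) := by
    have : (D \ Iio β) ∩ Iio (next D β) = {β} := by
      ext y
      simp only [mem_inter_iff, mem_sdiff, mem_Iio, not_lt, mem_singleton_iff]
      refine ⟨fun hy => (le_of_lt_next hy.1.1 hy.2).antisymm hy.1.2, ?_⟩
      rintro rfl
      exact ⟨⟨hβ, le_rfl⟩, h'⟩
    rw [this, otp, Ordinal.type_fintype]
    simp
  exact ⟨0, hσ, hnth ▸ otp_inter_Iio_lt hmem, hmem, hnth⟩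

theorem next_next_mem_suc {D : Set Ordinal.{u}} {β γ : Ordinal.{u}} (hβ : β ∈ D)
    (hγ : γ = next D β) (h : γ ∈ D) (h' : β < γ) (h2 : next D γ ∈ D) (h2' : γ < next D γ) :
    next D γ ∈ suc 2 (D \ Iio β) := by
  have hmem : next D γ ∈ D \ Iio β := ⟨h2, (h'.trans h2').not_gt⟩
  have hnth : otp ((D \ Iio β) ∩ Iio (next D γ)) = Ordinal.lift.{u + 1, u} (1 + 1) := by
    have : (D \ Iio β) ∩ Iio (next D γ) = {β, γ} := by
      ext y
      simp only [mem_inter_iff, mem_sdiff, mem_Iio, not_lt, mem_singleton_iff, mem_insert_iff]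
      constructor
      · rintro ⟨⟨hy, hle⟩, hlt⟩
        rcases (le_of_lt_next hy hlt).lt_or_eq with h3 | h3
        · exact Or.inl ((le_of_lt_next hy (hγ ▸ h3)).antisymm hle)
        · exact Or.inr h3
      · rintro (rfl | rfl)
        · exact ⟨⟨hβ, le_rfl⟩, h'.trans h2'⟩
        · exact ⟨⟨h, h'.le⟩, h2'⟩
    have hcard : #({β, γ} : Set Ordinal.{u}) = 2 := by
      rw [mk_insert (by simpa using h'.ne), mk_singleton, one_add_one_eq_two]
    have hfin : Finite ({β, γ} : Set Ordinal.{u}) := Set.toFinite _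
    have hfin' := Fintype.ofFinite ({β, γ} : Set Ordinal.{u})
    rw [this, otp, Ordinal.type_fintype]
    rw [mk_fintype] at hcard
    have : Fintype.card ({β, γ} : Set Ordinal.{u}) = 2 := by exact_mod_cast hcard
    rw [this, one_add_one_eq_two]
    simp
  exact ⟨1, one_lt_two, hnth ▸ otp_inter_Iio_lt hmem, hmem, hnth⟩

theorem exists_mem_of_sSup_eq {E : Set Ordinal.{u}} {δ η : Ordinal.{u}} (h : sSup E = δ)
    (hη : η < δ) : ∃ β ∈ E, η < β := by
  by_contra! hcon
  exact hη.not_ge (h ▸ csSup_le' hcon)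

/-! ### Guessing two points in one interval. -/

theorem ProxyMinus.guesses_two {χ κ : Cardinal.{u}} (hκ : κ.IsRegular) (hκ' : ℵ₀ < κ)
    (h : ProxyMinus κ (InitSegStar χ) κ {Iio κ.ord} 2) :
    ∃ C, StarSeq χ κ.ord C ∧ ∀ θ < κ, Guesses (fun _ α => α) C κ θ := by
  classical
  obtain ⟨C, h1, h2, h3⟩ := h
  have S := StarSeq.of_initSegStar h1 h2
  refine ⟨C, S, fun θ hθ A hA ζ hζ => ?_⟩
  -- The family is padded to length `κ` by the trivial cofinal set; taking `δ` above `θ` makes every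
  -- `i < θ` fall under the guess.
  have hT := h3 (fun i => if i < θ.ord then A i else Iio κ.ord) (fun i _ => by
    by_cases hi : i < θ.ord
    · simpa only [hi, if_true] using hA i hi
    · simpa only [hi, if_false] using ⟨subset_rfl, fun β hβ => ⟨β, hβ, le_rfl⟩⟩) _ rfl
  obtain ⟨δ, ⟨-, hδT⟩, hδζ, hδ, hlim⟩ :=
    hT.exists_isSuccLimit hκ hκ' (max_lt hζ (ord_lt_ord.2 hθ))
  obtain ⟨hζδ, hθδ⟩ := max_lt_iff.1 hδζ
  refine ⟨δ, hζδ, hδ, hlim, fun i hi η hη => ?_⟩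
  obtain ⟨β, ⟨hβ, hsuc⟩, hηβ⟩ := exists_mem_of_sSup_eq
    (hδT i (lt_min (hi.trans hθδ) (hi.trans (hθδ.trans hδ)))) hη
  simp only [hi, if_true] at hsuc
  have hub := S.unbdd δ hδ hlim
  have hsub := S.sub δ hδ hlim
  obtain ⟨hγ, hβγ⟩ := hub.next_mem hlim (hsub hβ)
  obtain ⟨hα, hγα⟩ := hub.next_mem hlim (hsub hγ)
  have hpre := pre_next hγ hγα
  refine ⟨_, _, ⟨hα, rfl, by rwa [hpre], le_rfl⟩, hsub hα, ?_, ?_, next (C δ) β, ?_, hpre.le,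
    hγα⟩
  · rw [hpre]
    exact (hηβ.trans hβγ).le
  · exact hsuc (next_next_mem_suc hβ rfl hγ hβγ hα hγα)
  · exact hsuc (next_mem_suc two_pos hβ hγ hβγ)

theorem Proxy.guesses_one {χ κ θ : Cardinal.{u}} (hκ : κ.IsRegular) (hκ' : ℵ₀ < κ) (hθ : θ < κ)
    (h : ProxyMinus κ (InitSegStar χ) θ {Iio κ.ord} 1) (hd : Diamond κ) :
    ∃ f C, StarSeq χ κ.ord C ∧ Guesses f C κ θ := by
  obtain ⟨C, h1, h2, h3⟩ := h
  obtain ⟨S, -, hS⟩ := hd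
  have hC := StarSeq.of_initSegStar h1 h2
  -- The selected level is the second element of the diamond set `S α` above `γ`; the first one
  -- serves as the separating point.
  refine ⟨fun γ α => next (S α) (next (S α) γ), C, hC, fun A hA ζ hζ => ?_⟩
  -- Applied to the points where diamond guesses `A i` correctly and which are limits of `A i`, so
  -- that one correct successor in `C δ` already supplies two elements of `A i` below it.
  have hT := h3
    (fun i => {α | α < κ.ord ∧ A i ∩ Iio α = S α ∧ ∀ b < α, ∃ y ∈ A i, b < y ∧ y < α})
    (fun i hi => ⟨fun α hα => hα.1, fun β hβ => by
      obtain ⟨α, h1, h2, h3, h4⟩ :=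
        (hS (A i) (hA i hi).1).exists_limitPoint hκ hκ' (hA i hi) hβ
      exact ⟨α, ⟨h3, h1, h4⟩, h2.le⟩⟩) _ rfl
  obtain ⟨δ, ⟨-, hδT⟩, hδζ, hδ, hlim⟩ :=
    hT.exists_isSuccLimit hκ hκ' (max_lt hζ (ord_lt_ord.2 hθ))
  obtain ⟨hζδ, hθδ⟩ := max_lt_iff.1 hδζ
  refine ⟨δ, hζδ, hδ, hlim, fun i hi η hη => ?_⟩
  obtain ⟨β, ⟨hβ, hsuc⟩, hηβ⟩ := exists_mem_of_sSup_eq (hδT i (lt_min (hi.trans hθδ) hi)) hη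
  have hub := hC.unbdd δ hδ hlim
  have hsub := hC.sub δ hδ hlim
  obtain ⟨hα, hβα⟩ := hub.next_mem hlim (hsub hβ)
  have hpre := pre_next hβ hβα
  obtain ⟨-, hSα, hlimα⟩ := hsuc (next_mem_suc one_pos hβ hα hβα)
  have hnext : ∀ b < next (C δ) β, next (S (next (C δ) β)) b ∈ A i ∧
      next (S (next (C δ) β)) b < next (C δ) β ∧ b < next (S (next (C δ) β)) b := by
    intro b hb
    obtain ⟨y, h4, h5, h6⟩ := hlimα b hb
    have := csInf_mem (s := S (next (C δ) β) ∩ Ioi b) ⟨y, hSα ▸ ⟨h4, h6⟩, h5⟩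
    have h7 : next (S (next (C δ) β)) b ∈ A i ∩ Iio (next (C δ) β) := hSα.symm ▸ this.1
    exact ⟨h7.1, h7.2, this.2⟩
  obtain ⟨h4, h5, h6⟩ := hnext β hβα
  obtain ⟨h7, h8, h9⟩ := hnext _ h5
  refine ⟨next (C δ) β, next (S (next (C δ) β)) (next (S (next (C δ) β)) β),
    ⟨hα, by rw [hpre], by rw [hpre]; exact h6.trans h9, h8.le⟩, hsub hα, ?_, h7, _, h4, ?_, h9⟩
  · rw [hpre]
    exact hηβ.le
  · rw [hpre]
    exact h6.le

theorem exists_isChromaticGT_of_proxy {χ κ θ : Cardinal.{u}} (hχ : χ.IsRegular)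
    (hκ : κ.IsRegular) (hχκ : χ < κ) (hθκ : θ < κ)
    (h : ProxyMinus κ (InitSegStar χ) θ {Iio κ.ord} 1) (hd : Diamond κ) :
    ∃ (V : Type u) (G : SimpleGraph V), #V = κ ∧ IsChromaticGT G χ θ := by
  -- The definition of `(χ, ν)`-chromatic demands `χ ≤ ν`, which `ν > θ` ensures only when `χ ≤ θ`.
  rcases lt_or_ge θ χ with hθ | hθ
  · exact exists_isChromaticGT_of_lt hχκ hθ
  · obtain ⟨f, C, hC, hG⟩ := Proxy.guesses_one hκ (hχ.aleph0_le.trans_lt hχκ) hθκ h hd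
    exact exists_isChromaticGT hχ hκ hχκ hθκ hθ hC hG

theorem exists_isChromatic_of_proxyMinus {χ κ : Cardinal.{u}} (hχ : χ.IsRegular)
    (hκ : κ.IsRegular) (hχκ : χ < κ) (h : ProxyMinus κ (InitSegStar χ) κ {Iio κ.ord} 2) :
    ∃ (V : Type u) (G : SimpleGraph V), #V = κ ∧ IsChromatic G χ κ := by
  obtain ⟨C, hC, hG⟩ := h.guesses_two hκ (hχ.aleph0_le.trans_lt hχκ)
  exact exists_isChromatic hχ hκ hχκ hC hG

end CSeq

theorem mainTheorem7 (χ κ θ : Cardinal.{u}) (hχ : χ.IsRegular) (hκ : κ.IsRegular)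
    (hχκ : χ < κ) (hθκ : θ < κ) :
    (CSeq.Proxy κ (CSeq.InitSegSub χ) θ {Set.Iio κ.ord} 1 →
      ∃ (V : Type u) (G : SimpleGraph V), Cardinal.mk V = κ ∧ CSeq.IsChromaticGT G χ θ) ∧
    (CSeq.ProxyMinus κ (CSeq.InitSegSub χ) κ {Set.Iio κ.ord} 2 →
      ∃ (V : Type u) (G : SimpleGraph V), Cardinal.mk V = κ ∧ CSeq.IsChromatic G χ κ) ∧
    (CSeq.ProxyMinus κ (CSeq.InitSegStar χ) κ {CSeq.cofGE κ χ} 2 →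
      ∃ (V : Type u) (G : SimpleGraph V), Cardinal.mk V = κ ∧ CSeq.IsChromatic G χ κ) ∧
    (CSeq.Proxy κ (CSeq.InitSegStar χ) θ {CSeq.cofGE κ χ} 1 →
      ∃ (V : Type u) (G : SimpleGraph V), Cardinal.mk V = κ ∧ CSeq.IsChromaticGT G χ θ) := by
  have hsub : CSeq.cofGE κ χ ⊆ Set.Iio κ.ord := fun α hα => hα.1
  exact ⟨fun h => CSeq.exists_isChromaticGT_of_proxy hχ hκ hχκ hθκ h.1.initSegStar h.2,
    fun h => CSeq.exists_isChromatic_of_proxyMinus hχ hκ hχκ h.initSegStar,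
    fun h => CSeq.exists_isChromatic_of_proxyMinus hχ hκ hχκ (h.mono hsub),
    fun h => CSeq.exists_isChromaticGT_of_proxy hχ hκ hχκ hθκ (h.1.mono hsub) h.2⟩
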